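/- Let $m\ge 3$ and let $\Gamma=\mathbb{C}_m+\mathbb{P}_\infty$ be the unweighted graph obtained from the $m$-cycle $\mathbb{C}_m$ and the one-sided infinite path $\mathbb{P}_\infty$ by joining the initial vertex of the path to one vertex of the cycle by a new edge. Let $A(\Gamma)$ be its adjacency operator on $\ell^2(V(\Gamma))$, $(A(\Gamma)f)(v)=\sum_{w\sim v}f(w)$, let $\sigma(\Gamma)$ be the spectrum of $A(\Gamma)$, and let $\sigma_d(\Gamma)$ (the discrete component) be the set of all eigenvalues of $A(\Gamma)$, including those lying in $[-2,2]$. Then $$\sigma(\Gamma)=[-2,2]\cup\sigma_d(\Gamma).$$ Put $p(x)=x^m+2x^2-1$ and $l=\lfloor (m-1)/2\rfloor$. If $m\ge 4$, then $p$ has exactly one root $x_1$ in $(0,1)$ and exactly one root $x_2$ in $(-1,0)$, and $$\sigma_d(\Gamma)=\Bigl\{2\cos\frac{2\pi k}{m}\Bigr\}_{k=1}^{l}\cup\Bigl\{x_1+\frac1{x_1},\;x_2+\frac1{x_2}\Bigr\}.$$ If $m=3$, then $p$ has exactly one root $x_1$ in $(0,1)$ and no root in $(-1,0)$, and $$\sigma_d(\Gamma)=\Bigl\{2\cos\frac{2\pi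 k}{m}\Bigr\}_{k=1}^{l}\cup\Bigl\{x_1+\frac1{x_1}\Bigr\}.$$ -/

import Mathlib

open scoped ENNReal

noncomputable section

namespace TailGraph

variable {V W : Type*}

/-- A graph is uniformly locally finite if its vertex degrees are bounded. -/
def UniformlyLocallyFinite (G : SimpleGraph V) : Prop :=
  ∃ D : ℕ, ∀ v : V, (G.neighborSet v).encard ≤ (D : ℕ∞)

theorem UniformlyLocallyFinite.finite_neighborSet {G : SimpleGraph V}
    (hG : UniformlyLocallyFinite G) (v : V) : (G.neighborSet v).Finite := by
  obtain ⟨D, hD⟩ := hG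
  exact Set.finite_of_encard_le_coe (hD v)

/-- The complex Hilbert space `ℓ²(V)` of square-summable functions on the vertex set. -/
abbrev EllTwo (V : Type*) : Type _ := lp (fun _ : V => ℂ) 2

theorem sum_adj_sq_le {G : SimpleGraph V} (D : ℕ)
    (hD : ∀ v : V, (G.neighborSet v).encard ≤ (D : ℕ∞)) (f : EllTwo V) (s : Finset V) :
    ∑ v ∈ s, ‖∑ᶠ w ∈ G.neighborSet v, f w‖ ^ (2 : ℝ≥0∞).toReal
      ≤ ((D : ℝ) * ‖f‖) ^ (2 : ℝ≥0∞).toReal := by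
  classical
  have hfin : ∀ v, (G.neighborSet v).Finite := fun v => Set.finite_of_encard_le_coe (hD v)
  set N : V → Finset V := fun v => (hfin v).toFinset with hN
  have hcard : ∀ v, ((N v).card : ℝ) ≤ D := by
    intro v
    have h := hD v
    rw [(hfin v).encard_eq_coe_toFinset_card] at h
    exact_mod_cast h
  have hp : 0 < (2 : ℝ≥0∞).toReal := by norm_num
  have hmem : ∀ v w, w ∈ N v ↔ v ∈ N w := by
    intro v w
    simp [hN, G.adj_comm]
  have h1 : ∀ v, ‖∑ᶠ w ∈ G.neighborSet v, f w‖ ^ 2 ≤ D * ∑ w ∈ N v, ‖f w‖ ^ 2 := by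
    intro v
    rw [finsum_mem_eq_finite_toFinset_sum _ (hfin v)]
    calc ‖∑ w ∈ N v, f w‖ ^ 2 ≤ (∑ w ∈ N v, ‖f w‖) ^ 2 := by
            gcongr
            exact norm_sum_le _ _
      _ ≤ (N v).card * ∑ w ∈ N v, ‖f w‖ ^ 2 := sq_sum_le_card_mul_sum_sq
      _ ≤ D * ∑ w ∈ N v, ‖f w‖ ^ 2 := by
            exact mul_le_mul_of_nonneg_right (hcard v) (by positivity)
  have h2 : ∑ v ∈ s, ∑ w ∈ N v, ‖f w‖ ^ 2 ≤ D * ‖f‖ ^ 2 := by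
    have h3 : ∑ v ∈ s, ∑ w ∈ N v, ‖f w‖ ^ 2
        = ∑ w ∈ s.biUnion N, ∑ v ∈ s.filter (fun v => v ∈ N w), ‖f w‖ ^ 2 := by
      refine Finset.sum_comm' ?_
      intro v w
      simp only [Finset.mem_biUnion, Finset.mem_filter]
      constructor
      · rintro ⟨hv, hw⟩
        exact ⟨⟨hv, (hmem v w).1 hw⟩, v, hv, hw⟩
      · rintro ⟨⟨hv, hw⟩, -⟩
        exact ⟨hv, (hmem v w).2 hw⟩
    rw [h3]
    have h4 : ∑ w ∈ s.biUnion N, ‖f w‖ ^ 2 ≤ ‖f‖ ^ 2 := by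
      have := lp.sum_rpow_le_norm_rpow hp f (s.biUnion N)
      simpa using this
    calc ∑ w ∈ s.biUnion N, ∑ v ∈ s.filter (fun v => v ∈ N w), ‖f w‖ ^ 2
        ≤ ∑ w ∈ s.biUnion N, D * ‖f w‖ ^ 2 := by
          refine Finset.sum_le_sum fun w _ => ?_
          rw [Finset.sum_const, nsmul_eq_mul]
          refine mul_le_mul_of_nonneg_right (le_trans ?_ (hcard w)) (by positivity)
          exact_mod_cast Finset.card_le_card (fun v hv => (Finset.mem_filter.1 hv).2)
      _ = D * ∑ w ∈ s.biUnion N, ‖f w‖ ^ 2 := by rw [Finset.mul_sum]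
      _ ≤ D * ‖f‖ ^ 2 := by gcongr
  have h5 : ∑ v ∈ s, ‖∑ᶠ w ∈ G.neighborSet v, f w‖ ^ 2 ≤ ((D : ℝ) * ‖f‖) ^ 2 := by
    calc ∑ v ∈ s, ‖∑ᶠ w ∈ G.neighborSet v, f w‖ ^ 2
        ≤ ∑ v ∈ s, D * ∑ w ∈ N v, ‖f w‖ ^ 2 := Finset.sum_le_sum fun v _ => h1 v
      _ = D * ∑ v ∈ s, ∑ w ∈ N v, ‖f w‖ ^ 2 := by rw [Finset.mul_sum]
      _ ≤ D * (D * ‖f‖ ^ 2) := by gcongr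
      _ = ((D : ℝ) * ‖f‖) ^ 2 := by ring
  simpa using h5

/-- The function `v ↦ ∑_{w ∼ v} f w`, as an element of `ℓ²(V)`. -/
def adjacencyFun (G : SimpleGraph V) (hG : UniformlyLocallyFinite G) (f : EllTwo V) :
    EllTwo V :=
  ⟨fun v => ∑ᶠ w ∈ G.neighborSet v, f w, by
    obtain ⟨D, hD⟩ := hG
    exact memℓp_gen' (sum_adj_sq_le D hD f)⟩

/-- The adjacency operator of an unweighted, uniformly locally finite graph: the bounded operator
on `ℓ²(V)` given by `(A f)(v) = ∑_{w ∼ v} f(w)`. -/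
def adjacencyOperator (G : SimpleGraph V) (hG : UniformlyLocallyFinite G) :
    EllTwo V →L[ℂ] EllTwo V :=
  LinearMap.mkContinuousOfExistsBound
    { toFun := adjacencyFun G hG
      map_add' := by
        intro f g
        ext v
        change ∑ᶠ w ∈ G.neighborSet v, (f w + g w)
          = (∑ᶠ w ∈ G.neighborSet v, f w) + ∑ᶠ w ∈ G.neighborSet v, g w
        exact finsum_mem_add_distrib (hG.finite_neighborSet v)
      map_smul' := by
        intro c f
        ext v
        change ∑ᶠ w ∈ G.neighborSet v, (c * f w) = c * ∑ᶠ w ∈ G.neighborSet v, f w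
        exact (mul_finsum_mem (f := fun w => f w) (s := G.neighborSet v) c).symm }
    (by
      obtain ⟨D, hD⟩ := id hG
      refine ⟨D, fun f => ?_⟩
      exact lp.norm_le_of_forall_sum_le (by norm_num) (by positivity) (sum_adj_sq_le D hD f))

theorem adjacencyOperator_apply (G : SimpleGraph V) (hG : UniformlyLocallyFinite G)
    (f : EllTwo V) (v : V) :
    adjacencyOperator G hG f v = ∑ᶠ w ∈ G.neighborSet v, f w := rfl

/-- The coupling of two graphs by the (unweighted) bridge `{v, w}`: the disjoint union together
with one new edge between `v` and `w`. -/
def coupling (G : SimpleGraph V) (v : V) (H : SimpleGraph W) (w : W) : SimpleGraph (V ⊕ W) :=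
  (G ⊕g H) ⊔ SimpleGraph.edge (Sum.inl v) (Sum.inr w)

theorem UniformlyLocallyFinite.coupling {G : SimpleGraph V} {H : SimpleGraph W}
    (hG : UniformlyLocallyFinite G) (hH : UniformlyLocallyFinite H) (v : V) (w : W) :
    UniformlyLocallyFinite (coupling G v H w) := by
  obtain ⟨D, hD⟩ := hG
  obtain ⟨E, hE⟩ := hH
  refine ⟨D + E + 1, ?_⟩
  have hDE : (D : ℕ∞) ≤ ((D + E : ℕ) : ℕ∞) := by exact_mod_cast Nat.le_add_right D E
  have hED : (E : ℕ∞) ≤ ((D + E : ℕ) : ℕ∞) := by exact_mod_cast Nat.le_add_left E D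
  rintro (x | x)
  · have hsub : (TailGraph.coupling G v H w).neighborSet (Sum.inl x)
        ⊆ insert (Sum.inr w) (Sum.inl '' G.neighborSet x) := by
      rintro (y | y) hy
      · simpa [TailGraph.coupling, SimpleGraph.edge_adj] using hy
      · have : x = v ∧ y = w := by
          simpa [TailGraph.coupling, SimpleGraph.edge_adj] using hy
        simp [this.2]
    refine (Set.encard_le_encard hsub).trans ((Set.encard_insert_le _ _).trans ?_)
    push_cast
    gcongr
    exact (Set.encard_image_le _ _).trans ((hD x).trans (by exact_mod_cast hDE))
  · have hsub : (TailGraph.coupling G v H w).neighborSet (Sum.inr x)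
        ⊆ insert (Sum.inl v) (Sum.inr '' H.neighborSet x) := by
      rintro (y | y) hy
      · have : x = w ∧ y = v := by
          simpa [TailGraph.coupling, SimpleGraph.edge_adj] using hy
        simp [this.2]
      · simpa [TailGraph.coupling, SimpleGraph.edge_adj] using hy
    refine (Set.encard_le_encard hsub).trans ((Set.encard_insert_le _ _).trans ?_)
    push_cast
    gcongr
    exact (Set.encard_image_le _ _).trans ((hE x).trans (by exact_mod_cast hED))

/-- The one-sided infinite path `0 ∼ 1 ∼ 2 ∼ ⋯`. -/
def infinitePath : SimpleGraph ℕ := SimpleGraph.fromRel fun i j => j = i + 1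

theorem uniformlyLocallyFinite_infinitePath : UniformlyLocallyFinite infinitePath := by
  refine ⟨2, fun n => ?_⟩
  have hsub : infinitePath.neighborSet n ⊆ {n + 1, n - 1} := by
    intro k hk
    have hk' : n ≠ k ∧ (k = n + 1 ∨ n = k + 1) := by
      simpa [infinitePath, SimpleGraph.fromRel_adj] using hk
    simp only [Set.mem_insert_iff, Set.mem_singleton_iff]
    omega
  refine (Set.encard_le_encard hsub).trans ((Set.encard_insert_le _ _).trans ?_)
  rw [Set.encard_singleton]
  norm_num

theorem uniformlyLocallyFinite_of_finite [Finite V] (G : SimpleGraph V) :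
    UniformlyLocallyFinite G := by
  classical
  have := Fintype.ofFinite V
  refine ⟨Fintype.card V, fun v => ?_⟩
  refine (Set.encard_le_encard (Set.subset_univ _)).trans ?_
  rw [Set.encard_univ, ENat.card_eq_coe_fintype_card]

/-- The kite: the `m`-cycle with the infinite path attached, by a bridge, to its vertex `v`. -/
def kite (m : ℕ) (v : Fin m) : SimpleGraph (Fin m ⊕ ℕ) :=
  coupling (SimpleGraph.cycleGraph m) v infinitePath 0

theorem uniformlyLocallyFinite_kite (m : ℕ) (v : Fin m) : UniformlyLocallyFinite (kite m v) :=
  (uniformlyLocallyFinite_of_finite _).coupling uniformlyLocallyFinite_infinitePath v 0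

/-- The spectrum of a uniformly locally finite graph: the spectrum of its adjacency operator on
the complex Hilbert space `ℓ²(V)`. -/
def graphSpectrum (G : SimpleGraph V) (hG : UniformlyLocallyFinite G) : Set ℂ :=
  spectrum ℂ (adjacencyOperator G hG)

/-- The discrete component of the spectrum: the set of all eigenvalues of the adjacency operator
(eigenvalues that lie inside the continuous spectrum are included). -/
def discreteComponent (G : SimpleGraph V) (hG : UniformlyLocallyFinite G) : Set ℂ :=
  {μ | ∃ f : EllTwo V, f ≠ 0 ∧ adjacencyOperator G hG f = μ • f}

end TailGraph

end

noncomputable section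

namespace TailGraph

variable {V W : Type*}

/-! The spectrum is handled in two halves. Off `[-2,2]` the path operator has a bounded resolvent,
so solving `(A - μ) f = h` on the kite reduces to a square linear system on the finite cycle. There
injectivity gives surjectivity, so a spectral value must be an eigenvalue
(`graphSpectrum_kite_subset`). Conversely, truncated plane waves along the path are approximate
eigenvectors for every point of `[-2,2]` (`Icc_subset_graphSpectrum_kite`).

For eigenvalues, write `μ = x + x⁻¹` with `‖x‖ ≤ 1`. Square-summability makes the eigenfunction a
multiple of `x ^ k` along the path (`eq_mul_pow_of_summable`). If it vanishes at the junction, it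
lives on the cycle and is odd under the reflection fixing the junction, which forces `x ^ m = 1`
with `x ^ 2 ≠ 1` and gives the cosines. Otherwise `‖x‖ < 1`, it is even under that reflection, and
the junction equation is exactly `p(x) = 0` (`IsKiteSolution.pow_eq_one_or`). Self-adjointness makes
`μ`, hence `x`, real in this case, so only the real roots of `p` in `(-1,1)` remain to be counted.
-/

/-! ### General facts: self-adjointness, norm bound, eigenvalues in the spectrum. -/

theorem isSelfAdjoint_adjacencyOperator (G : SimpleGraph V) (hG : UniformlyLocallyFinite G) :
    IsSelfAdjoint (adjacencyOperator G hG) := by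
  classical
  -- The matrix entries in the standard basis are real and symmetric, and a bounded operator is
  -- determined by its values on that basis.
  have hs : ∀ (i j : V), adjacencyOperator G hG (lp.single 2 i (1 : ℂ)) j
      = if G.Adj i j then 1 else 0 := by
    intro i j
    rw [adjacencyOperator_apply, finsum_mem_def]
    rw [finsum_eq_single _ i]
    · simp [Set.indicator_apply, G.adj_comm]
    · intro w hw
      simp [lp.single_apply, hw]
  rw [ContinuousLinearMap.isSelfAdjoint_iff']
  refine lp.ext_continuousLinearMap (by norm_num) fun i => ?_
  ext j
  rw [ContinuousLinearMap.comp_apply, ContinuousLinearMap.comp_apply,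
    lp.singleContinuousLinearMap_apply, hs]
  have h := lp.inner_single_left (𝕜 := ℂ) (G := fun _ : V => ℂ) j 1
    (ContinuousLinearMap.adjoint (adjacencyOperator G hG) (lp.single 2 i (1 : ℂ)))
  rw [ContinuousLinearMap.adjoint_inner_right, lp.inner_single_right, hs] at h
  simp only [RCLike.inner_apply, map_one, mul_one, one_mul] at h
  rw [← h]
  rw [G.adj_comm j i]
  split_ifs <;> simp

theorem norm_adjacencyOperator_le (G : SimpleGraph V) (hG : UniformlyLocallyFinite G) (D : ℕ)
    (hD : ∀ v : V, (G.neighborSet v).encard ≤ (D : ℕ∞)) : ‖adjacencyOperator G hG‖ ≤ D :=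
  ContinuousLinearMap.opNorm_le_bound _ (by positivity) fun f =>
    lp.norm_le_of_forall_sum_le (by norm_num) (by positivity) (sum_adj_sq_le D hD f)

theorem conj_eq_of_mem_graphSpectrum {G : SimpleGraph V} {hG : UniformlyLocallyFinite G} {μ : ℂ}
    (h : μ ∈ graphSpectrum G hG) : (starRingEnd ℂ) μ = μ := by
  have := (isSelfAdjoint_adjacencyOperator G hG).mem_spectrum_eq_re h
  rw [this, Complex.conj_ofReal]

theorem discreteComponent_subset_graphSpectrum (G : SimpleGraph V)
    (hG : UniformlyLocallyFinite G) : discreteComponent G hG ⊆ graphSpectrum G hG := by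
  rintro μ ⟨f, hf, h⟩
  rw [graphSpectrum, spectrum.mem_iff, ContinuousLinearMap.isUnit_iff_bijective]
  intro hb
  refine hf (hb.1 ?_)
  rw [map_zero]
  simp [h, Algebra.algebraMap_eq_smul_one]

/-! ### The infinite path. -/

theorem infinitePath_adj {i j : ℕ} : infinitePath.Adj i j ↔ j = i + 1 ∨ i = j + 1 := by
  simp only [infinitePath, SimpleGraph.fromRel_adj]
  omega

theorem neighborSet_infinitePath_zero : infinitePath.neighborSet 0 = {1} := by
  ext j
  simp [infinitePath_adj]

theorem neighborSet_infinitePath_succ (k : ℕ) :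
    infinitePath.neighborSet (k + 1) = {k, k + 2} := by
  ext j
  simp only [SimpleGraph.mem_neighborSet, infinitePath_adj, Set.mem_insert_iff,
    Set.mem_singleton_iff]
  omega

theorem norm_adjacencyOperator_infinitePath_le :
    ‖adjacencyOperator infinitePath uniformlyLocallyFinite_infinitePath‖ ≤ 2 := by
  refine norm_adjacencyOperator_le _ _ 2 fun n => ?_
  cases n with
  | zero => rw [neighborSet_infinitePath_zero, Set.encard_singleton]; norm_num
  | succ k =>
    rw [neighborSet_infinitePath_succ]
    refine (Set.encard_insert_le _ _).trans ?_
    rw [Set.encard_singleton]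
    norm_num

instance [Nonempty V] : Nontrivial (EllTwo V) := by
  classical
  refine ⟨lp.single 2 (Classical.arbitrary V) (1 : ℂ), 0, fun h => ?_⟩
  have := congrArg norm h
  rw [lp.norm_single (by norm_num)] at this
  simp at this

/-- Self-adjointness makes the spectrum real, and degrees at most 2 bound the norm by 2. Only this
inclusion is needed. -/
theorem graphSpectrum_infinitePath_subset :
    graphSpectrum infinitePath uniformlyLocallyFinite_infinitePath
      ⊆ (fun t : ℝ => (t : ℂ)) '' Set.Icc (-2) 2 := by
  intro μ hμ
  have h1 : μ = μ.re := (isSelfAdjoint_adjacencyOperator _ _).mem_spectrum_eq_re hμ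
  have h2 : ‖μ‖ ≤ 2 :=
    (spectrum.norm_le_norm_of_mem hμ).trans norm_adjacencyOperator_infinitePath_le
  exact ⟨μ.re, abs_le.1 ((Complex.abs_re_le_norm μ).trans h2), h1.symm⟩

/-! ### The adjacency operator of the kite in coordinates. -/

theorem memℓp_two_iff {f : V → ℂ} : Memℓp f 2 ↔ Summable fun v => ‖f v‖ ^ 2 := by
  rw [memℓp_gen_iff (by norm_num)]
  simp

theorem memℓp_sum_iff [Finite V] {f : V ⊕ W → ℂ} :
    Memℓp f 2 ↔ Memℓp (fun w => f (Sum.inr w)) 2 := by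
  rw [memℓp_two_iff, memℓp_two_iff]
  constructor
  · exact fun h => h.comp_injective Sum.inr_injective
  · exact fun h => Summable.sum _
      (summable_of_hasFiniteSupport (Set.toFinite _)) h

theorem finsum_neighborSet_coupling_inl {G : SimpleGraph V} {H : SimpleGraph W} {v : V} {w : W}
    {x : V} (hG : (G.neighborSet x).Finite) (f : V ⊕ W → ℂ) :
    ∑ᶠ y ∈ (coupling G v H w).neighborSet (Sum.inl x), f y
      = ∑ᶠ y ∈ G.neighborSet x, f (Sum.inl y)
        + (open Classical in if x = v then f (Sum.inr w) else 0) := by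
  classical
  have h : (coupling G v H w).neighborSet (Sum.inl x)
      = Sum.inl '' G.neighborSet x ∪ (if x = v then {Sum.inr w} else ∅) := by
    ext (y | y)
    · split_ifs <;> simp [coupling, SimpleGraph.edge_adj]
    · split_ifs with hx <;> simp [coupling, SimpleGraph.edge_adj, hx]
  rw [h, finsum_mem_union _ (hG.image _) (by split_ifs <;> simp),
    finsum_mem_image Sum.inl_injective.injOn]
  · split_ifs <;> simp
  · split_ifs <;> simp

theorem finsum_neighborSet_coupling_inr {G : SimpleGraph V} {H : SimpleGraph W} {v : V} {w : W}
    {x : W} (hH : (H.neighborSet x).Finite) (f : V ⊕ W → ℂ) :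
    ∑ᶠ y ∈ (coupling G v H w).neighborSet (Sum.inr x), f y
      = ∑ᶠ y ∈ H.neighborSet x, f (Sum.inr y)
        + (open Classical in if x = w then f (Sum.inl v) else 0) := by
  classical
  have h : (coupling G v H w).neighborSet (Sum.inr x)
      = Sum.inr '' H.neighborSet x ∪ (if x = w then {Sum.inl v} else ∅) := by
    ext (y | y)
    · split_ifs with hx <;> simp [coupling, SimpleGraph.edge_adj, hx]
    · split_ifs <;> simp [coupling, SimpleGraph.edge_adj]
  rw [h, finsum_mem_union _ (hH.image _) (by split_ifs <;> simp),
    finsum_mem_image Sum.inr_injective.injOn]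
  · split_ifs <;> simp
  · split_ifs <;> simp

theorem adjacencyOperator_infinitePath_zero (f : EllTwo ℕ) :
    adjacencyOperator infinitePath uniformlyLocallyFinite_infinitePath f 0 = f 1 := by
  rw [adjacencyOperator_apply, neighborSet_infinitePath_zero, finsum_mem_singleton]

theorem adjacencyOperator_infinitePath_succ (f : EllTwo ℕ) (k : ℕ) :
    adjacencyOperator infinitePath uniformlyLocallyFinite_infinitePath f (k + 1)
      = f k + f (k + 2) := by
  rw [adjacencyOperator_apply, neighborSet_infinitePath_succ, finsum_mem_pair (by omega)]

variable {n : ℕ} {v : Fin (n + 3)}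

theorem adjacencyOperator_kite_inl (f : EllTwo (Fin (n + 3) ⊕ ℕ)) (u : Fin (n + 3)) :
    adjacencyOperator (kite (n + 3) v) (uniformlyLocallyFinite_kite _ v) f (Sum.inl u)
      = f (Sum.inl (u - 1)) + f (Sum.inl (u + 1)) + if u = v then f (Sum.inr 0) else 0 := by
  rw [adjacencyOperator_apply, kite, finsum_neighborSet_coupling_inl (Set.toFinite _),
    SimpleGraph.cycleGraph_neighborSet, finsum_mem_pair]
  · congr
  · intro h
    rw [sub_eq_iff_eq_add, add_assoc, left_eq_add] at h
    have h2 := congrArg Fin.val h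
    simp only [Fin.val_add, Fin.val_one, Fin.val_zero] at h2
    rw [Nat.mod_eq_of_lt (by omega)] at h2
    omega

theorem adjacencyOperator_kite_inr_zero (f : EllTwo (Fin (n + 3) ⊕ ℕ)) :
    adjacencyOperator (kite (n + 3) v) (uniformlyLocallyFinite_kite _ v) f (Sum.inr 0)
      = f (Sum.inr 1) + f (Sum.inl v) := by
  rw [adjacencyOperator_apply, kite, finsum_neighborSet_coupling_inr
    (uniformlyLocallyFinite_infinitePath.finite_neighborSet _), neighborSet_infinitePath_zero,
    finsum_mem_singleton, if_pos rfl]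

theorem adjacencyOperator_kite_inr_succ (f : EllTwo (Fin (n + 3) ⊕ ℕ)) (k : ℕ) :
    adjacencyOperator (kite (n + 3) v) (uniformlyLocallyFinite_kite _ v) f (Sum.inr (k + 1))
      = f (Sum.inr k) + f (Sum.inr (k + 2)) := by
  rw [adjacencyOperator_apply, kite, finsum_neighborSet_coupling_inr
    (uniformlyLocallyFinite_infinitePath.finite_neighborSet _), neighborSet_infinitePath_succ,
    finsum_mem_pair (by omega), if_neg (by omega), add_zero]

/-- The element of `ℓ²(V ⊕ W)` with given restrictions to the finite set `V` and to `W`. -/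
def glue [Finite V] (c : V → ℂ) (p : EllTwo W) : EllTwo (V ⊕ W) :=
  ⟨Sum.elim c p, memℓp_sum_iff.2 (lp.memℓp p)⟩

@[simp] theorem glue_inl [Finite V] (c : V → ℂ) (p : EllTwo W) (x : V) :
    glue c p (Sum.inl x) = c x := rfl

@[simp] theorem glue_inr [Finite V] (c : V → ℂ) (p : EllTwo W) (y : W) :
    glue c p (Sum.inr y) = p y := rfl

theorem adjacencyOperator_kite_glue_inr (c : Fin (n + 3) → ℂ) (p : EllTwo ℕ) (k : ℕ) :
    adjacencyOperator (kite (n + 3) v) (uniformlyLocallyFinite_kite _ v) (glue c p) (Sum.inr k)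
      = adjacencyOperator infinitePath uniformlyLocallyFinite_infinitePath p k
        + c v * lp.single (E := fun _ : ℕ => ℂ) 2 0 1 k := by
  cases k with
  | zero =>
    rw [adjacencyOperator_kite_inr_zero, adjacencyOperator_infinitePath_zero]
    simp
  | succ k =>
    rw [adjacencyOperator_kite_inr_succ, adjacencyOperator_infinitePath_succ]
    simp [lp.single_apply]

/-! ### Outside `[-2,2]` the spectrum consists of eigenvalues. -/

/-- A Schur complement argument: eliminating the path by its resolvent leaves an endomorphism `M` of
a finite-dimensional space. A kernel vector of `M` extends to an eigenfunction of the kite, and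
surjectivity of `M` yields surjectivity of `A - μ`. -/
theorem graphSpectrum_kite_subset :
    graphSpectrum (kite (n + 3) v) (uniformlyLocallyFinite_kite _ v)
      ⊆ (fun t : ℝ => (t : ℂ)) '' Set.Icc (-2) 2 ∪
        discreteComponent (kite (n + 3) v) (uniformlyLocallyFinite_kite _ v) := by
  intro μ hμ
  by_contra hcon
  rw [Set.mem_union, not_or] at hcon
  obtain ⟨hI, hd⟩ := hcon
  set A := adjacencyOperator (kite (n + 3) v) (uniformlyLocallyFinite_kite _ v) with hA
  set T := adjacencyOperator infinitePath uniformlyLocallyFinite_infinitePath with hT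
  have hinj : ∀ f, A f = μ • f → f = 0 := fun f hf => by
    by_contra h0
    exact hd ⟨f, h0, hf⟩
  have hTu : μ ∉ spectrum ℂ T := fun h => hI (graphSpectrum_infinitePath_subset h)
  rw [spectrum.notMem_iff, ContinuousLinearMap.isUnit_iff_bijective] at hTu
  have hTs : ∀ p : EllTwo ℕ, ∃ q : EllTwo ℕ, ∀ k, T q k = μ * q k + p k := by
    intro p
    obtain ⟨q, hq⟩ := hTu.2 (-p)
    refine ⟨q, fun k => ?_⟩
    have : T q = μ • q + p := by
      rw [← neg_neg p, ← hq]
      simp [Algebra.algebraMap_eq_smul_one]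
    rw [this]
    rfl
  -- `q` is the path's response to a unit source at its initial vertex. A cycle function `c` feeds
  -- in the source `c v`, which the path answers with `-c v • q`.
  obtain ⟨q, hq⟩ := hTs (lp.single 2 0 1)
  let M : (Fin (n + 3) → ℂ) →ₗ[ℂ] (Fin (n + 3) → ℂ) :=
    { toFun := fun c u => c (u - 1) + c (u + 1) - μ * c u - if u = v then c v * q 0 else 0
      map_add' := fun a b => by
        ext u
        simp only [Pi.add_apply]
        split_ifs <;> ring
      map_smul' := fun a b => by
        ext u
        simp only [Pi.smul_apply, smul_eq_mul, RingHom.id_apply]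
        split_ifs <;> ring }
  have hM : ∀ c u, M c u
      = c (u - 1) + c (u + 1) - μ * c u - if u = v then c v * q 0 else 0 := fun _ _ => rfl
  have hMinj : Function.Injective M := by
    rw [injective_iff_map_eq_zero]
    intro c hc
    have h0 : glue c ((-c v) • q) = 0 := by
      refine hinj _ ?_
      ext (u | k)
      · have := congrFun hc u
        rw [hM] at this
        rw [hA, adjacencyOperator_kite_inl]
        simp only [glue_inl, glue_inr, lp.coeFn_smul, Pi.smul_apply, smul_eq_mul,
          Pi.zero_apply] at this ⊢
        refine sub_eq_zero.1 (Eq.trans ?_ this)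
        split_ifs <;> ring
      · rw [hA, adjacencyOperator_kite_glue_inr, ← hT, map_smul]
        simp only [glue_inr, lp.coeFn_smul, Pi.smul_apply, smul_eq_mul, hq]
        ring
    ext u
    exact congrArg (fun f : EllTwo (Fin (n + 3) ⊕ ℕ) => f (Sum.inl u)) h0
  have hMsurj := LinearMap.injective_iff_surjective.1 hMinj
  rw [graphSpectrum, spectrum.mem_iff, ContinuousLinearMap.isUnit_iff_bijective] at hμ
  refine hμ ⟨?_, ?_⟩
  · rw [injective_iff_map_eq_zero]
    intro f hf
    refine hinj f ?_
    rw [sub_apply, sub_eq_zero] at hf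
    simpa [Algebra.algebraMap_eq_smul_one] using hf.symm
  · intro h
    obtain ⟨p, hp⟩ := hTs ⟨fun k => h (Sum.inr k), memℓp_sum_iff.1 (lp.memℓp h)⟩
    obtain ⟨c, hc⟩ := hMsurj fun u => h (Sum.inl u) - if u = v then p 0 else 0
    -- The sign appears because the spectrum is defined through `μ - A`, while `M` and `T` were
    -- solved for `A - μ`.
    refine ⟨-glue c (p - c v • q), ?_⟩
    ext (u | k)
    · have := congrFun hc u
      rw [hM] at this
      rw [map_neg, sub_apply]
      simp only [Algebra.algebraMap_eq_smul_one, smul_apply,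
        one_apply_eq_self, lp.coeFn_neg, lp.coeFn_sub, lp.coeFn_smul, Pi.neg_apply,
        Pi.sub_apply, Pi.smul_apply, smul_eq_mul, adjacencyOperator_kite_inl, glue_inl, glue_inr]
      refine sub_eq_zero.1 (Eq.trans ?_ (sub_eq_zero.2 this))
      split_ifs <;> ring
    · rw [map_neg, sub_apply]
      simp only [Algebra.algebraMap_eq_smul_one, smul_apply,
        one_apply_eq_self, lp.coeFn_neg, lp.coeFn_sub, lp.coeFn_smul, Pi.neg_apply,
        Pi.sub_apply, Pi.smul_apply, smul_eq_mul, adjacencyOperator_kite_glue_inr, glue_inr,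
        map_sub, map_smul]
      simp only [← hT, hp, hq]
      ring

/-! ### The interval `[-2,2]` lies in the spectrum. -/

theorem adjacencyOperator_kite_single_zero :
    adjacencyOperator (kite (n + 3) v) (uniformlyLocallyFinite_kite _ v)
        (lp.single 2 (Sum.inr 0) 1)
      = lp.single 2 (Sum.inl v) 1 + lp.single 2 (Sum.inr 1) 1 := by
  ext (u | k)
  · rw [adjacencyOperator_kite_inl]
    simp [lp.single_apply, Pi.single_apply]
  · rcases k with _ | k
    · rw [adjacencyOperator_kite_inr_zero]
      simp [lp.single_apply]
    · rw [adjacencyOperator_kite_inr_succ]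
      simp [lp.single_apply, Pi.single_apply]

theorem adjacencyOperator_kite_single_succ (j : ℕ) :
    adjacencyOperator (kite (n + 3) v) (uniformlyLocallyFinite_kite _ v)
        (lp.single 2 (Sum.inr (j + 1)) 1)
      = lp.single 2 (Sum.inr j) 1 + lp.single 2 (Sum.inr (j + 2)) 1 := by
  ext (u | k)
  · rw [adjacencyOperator_kite_inl]
    simp [lp.single_apply]
  · rcases k with _ | k
    · rw [adjacencyOperator_kite_inr_zero]
      simp [lp.single_apply, Pi.single_apply, eq_comm]
    · rw [adjacencyOperator_kite_inr_succ]
      simp [lp.single_apply, Pi.single_apply]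
      split_ifs <;> first | omega | simp

/-- For `t = z + z⁻¹` with `‖z‖ = 1`, the plane wave `z ^ k` cut off after `N + 1` path vertices
satisfies the eigenvalue equation up to four boundary terms of norm 1, while its norm is `√(N + 1)`.
No bounded inverse can exist. -/
theorem Icc_subset_graphSpectrum_kite :
    (fun t : ℝ => (t : ℂ)) '' Set.Icc (-2) 2
      ⊆ graphSpectrum (kite (n + 3) v) (uniformlyLocallyFinite_kite _ v) := by
  rintro _ ⟨t, ht, rfl⟩
  obtain ⟨z, hz1, hz⟩ : ∃ z : ℂ, ‖z‖ = 1 ∧ (t : ℂ) = z + z⁻¹ := by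
    refine ⟨Complex.exp (Real.arccos (t / 2) * Complex.I), Complex.norm_exp_ofReal_mul_I _, ?_⟩
    rw [← Complex.exp_neg, ← neg_mul, ← Complex.two_cos, ← Complex.ofReal_cos,
      Real.cos_arccos (by linarith [ht.1]) (by linarith [ht.2])]
    push_cast
    ring
  have hz0 : z ≠ 0 := by
    rintro rfl
    simp at hz1
  set A := adjacencyOperator (kite (n + 3) v) (uniformlyLocallyFinite_kite _ v) with hA
  let e : Fin (n + 3) ⊕ ℕ → EllTwo (Fin (n + 3) ⊕ ℕ) := fun i => lp.single 2 i 1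
  have he : ∀ i, ‖e i‖ = 1 := fun i => by simp [e, lp.norm_single]
  let f : ℕ → EllTwo (Fin (n + 3) ⊕ ℕ) := fun N =>
    ∑ k ∈ Finset.range (N + 1), z ^ k • e (Sum.inr k)
  -- The interior terms telescope; two defects remain at the junction end and two at the cut-off.
  have hAf : ∀ N, A (f N) - (t : ℂ) • f N
      = e (Sum.inl v) - z⁻¹ • e (Sum.inr 0) + z ^ N • e (Sum.inr (N + 1))
        - z ^ (N + 1) • e (Sum.inr N) := by
    intro N
    induction N with
    | zero =>
      have : f 0 = e (Sum.inr 0) := by simp [f]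
      rw [this, hA, adjacencyOperator_kite_single_zero, hz]
      simp only [e, zero_add, pow_zero, pow_one]
      module
    | succ N ih =>
      have : f (N + 1) = f N + z ^ (N + 1) • e (Sum.inr (N + 1)) := Finset.sum_range_succ _ _
      rw [this, map_add, map_smul, hA, adjacencyOperator_kite_single_succ, ← hA,
        smul_add (t : ℂ), smul_add (z ^ (N + 1)), add_sub_add_comm, ih, hz]
      have h3 : z ^ (N + 1) * z⁻¹ = z ^ N := by
        field_simp
        ring
      have h4 : ((z + z⁻¹) • z ^ (N + 1) • e (Sum.inr (N + 1)))
          = z ^ (N + 2) • e (Sum.inr (N + 1)) + z ^ N • e (Sum.inr (N + 1)) := by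
        rw [smul_smul, ← add_smul, ← h3]
        ring_nf
      rw [h4]
      simp only [e]
      module
  have hbound : ∀ N, ‖A (f N) - (t : ℂ) • f N‖ ≤ 4 := by
    intro N
    rw [hAf]
    refine (norm_sub_le _ _).trans ?_
    have h1 := norm_add_le (e (Sum.inl v) - z⁻¹ • e (Sum.inr 0)) (z ^ N • e (Sum.inr (N + 1)))
    have h2 := norm_sub_le (e (Sum.inl v)) (z⁻¹ • e (Sum.inr 0))
    simp only [norm_smul, norm_pow, norm_inv, hz1, he, one_pow, inv_one, mul_one] at h1 h2 ⊢
    linarith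
  have hnorm : ∀ N, ‖f N‖ ^ 2 = N + 1 := by
    intro N
    have := lp.norm_sum_single (p := 2) (E := fun _ : Fin (n + 3) ⊕ ℕ => ℂ) (by norm_num)
      (Sum.elim 0 fun k => z ^ k) ((Finset.range (N + 1)).map Function.Embedding.inr)
    simp only [Finset.sum_map, Function.Embedding.inr_apply, Sum.elim_inr, norm_pow, hz1,
      one_pow] at this
    have hf : f N = ∑ k ∈ Finset.range (N + 1), lp.single 2 (Sum.inr k) (z ^ k) := by
      refine Finset.sum_congr rfl fun k _ => ?_
      rw [← lp.single_smul, smul_eq_mul, mul_one]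
    rw [hf]
    simpa using this
  rw [graphSpectrum, spectrum.mem_iff]
  intro hu
  obtain ⟨u, hu⟩ := hu
  set B : EllTwo (Fin (n + 3) ⊕ ℕ) →L[ℂ] EllTwo (Fin (n + 3) ⊕ ℕ) :=
    ((u⁻¹ : (EllTwo (Fin (n + 3) ⊕ ℕ) →L[ℂ] EllTwo (Fin (n + 3) ⊕ ℕ))ˣ) :
      EllTwo (Fin (n + 3) ⊕ ℕ) →L[ℂ] EllTwo (Fin (n + 3) ⊕ ℕ)) with hB
  have hle : ∀ N, ‖f N‖ ≤ ‖B‖ * 4 := by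
    intro N
    have h1 : f N = B
        (-(A (f N) - (t : ℂ) • f N)) := by
      have h2 : -(A (f N) - (t : ℂ) • f N) = u.val (f N) := by
        rw [hu]
        simp [Algebra.algebraMap_eq_smul_one, hA]
        rfl
      rw [h2, hB, ← mul_apply_eq_comp, Units.inv_mul, one_apply_eq_self]
    calc ‖f N‖ = _ := congrArg norm h1
      _ ≤ _ := ContinuousLinearMap.le_opNorm _ _
      _ ≤ _ := by
        rw [norm_neg]
        exact mul_le_mul_of_nonneg_left (hbound N) (norm_nonneg _)
  set C := ‖B‖ * 4
  obtain ⟨N, hN⟩ := exists_nat_gt (C ^ 2)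
  have := pow_le_pow_left₀ (norm_nonneg _) (hle N) 2
  rw [hnorm] at this
  linarith

theorem graphSpectrum_kite :
    graphSpectrum (kite (n + 3) v) (uniformlyLocallyFinite_kite _ v)
      = (fun t : ℝ => (t : ℂ)) '' Set.Icc (-2) 2 ∪
        discreteComponent (kite (n + 3) v) (uniformlyLocallyFinite_kite _ v) :=
  graphSpectrum_kite_subset.antisymm (Set.union_subset Icc_subset_graphSpectrum_kite
    (discreteComponent_subset_graphSpectrum _ _))

/-! ### Eigenfunctions as solutions of scalar recurrences. -/

/-- The eigenvalue equation of the kite in coordinates: `c` runs around the cycle from the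
junction, and `g` runs from the junction along the path. -/
structure IsKiteSolution (m : ℕ) (μ : ℂ) (c g : ℕ → ℂ) : Prop where
  cycle : ∀ j, j + 1 < m → c j + c (j + 2) = μ * c (j + 1)
  closed : c m = c 0
  bridge : g 0 = c 0
  junction : c (m - 1) + c 1 + g 1 = μ * c 0
  path : ∀ k, g k + g (k + 2) = μ * g (k + 1)
  summable : Summable fun k => ‖g k‖ ^ 2

-- Here `c j` is the value at `v + j`, and `g` prepends the junction value to the path, so `g (k +
-- 1)` belongs to path vertex `k`. With this shift the equation at path vertex 0 is an ordinary
-- instance of the path recurrence.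
open Fin.CommRing in
theorem exists_isKiteSolution {μ : ℂ}
    (h : μ ∈ discreteComponent (kite (n + 3) v) (uniformlyLocallyFinite_kite _ v)) :
    ∃ c g, IsKiteSolution (n + 3) μ c g ∧ ((∃ j < n + 3, c j ≠ 0) ∨ ∃ k, g k ≠ 0) := by
  obtain ⟨f, hf, hAf⟩ := h
  have hl : ∀ u, f (Sum.inl (u - 1)) + f (Sum.inl (u + 1)) + (if u = v then f (Sum.inr 0) else 0)
      = μ * f (Sum.inl u) := fun u => by
    rw [← adjacencyOperator_kite_inl, hAf]
    rfl
  have h0 : f (Sum.inr 1) + f (Sum.inl v) = μ * f (Sum.inr 0) := by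
    rw [← adjacencyOperator_kite_inr_zero, hAf]
    rfl
  have hr : ∀ k, f (Sum.inr k) + f (Sum.inr (k + 2)) = μ * f (Sum.inr (k + 1)) := fun k => by
    rw [← adjacencyOperator_kite_inr_succ (v := v), hAf]
    rfl
  have hcast : ((n + 3 : ℕ) : Fin (n + 3)) = 0 := Fin.natCast_eq_zero.2 dvd_rfl
  refine ⟨fun j => f (Sum.inl (v + (j : Fin (n + 3)))),
    fun k => Nat.casesOn k (f (Sum.inl v)) fun k => f (Sum.inr k), ⟨?_, ?_, ?_, ?_, ?_, ?_⟩, ?_⟩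
  · intro j hj
    have h := hl (v + ((j + 1 : ℕ) : Fin (n + 3)))
    have hne : ((j + 1 : ℕ) : Fin (n + 3)) ≠ 0 := by
      intro h0
      have := congrArg Fin.val h0
      rw [Fin.val_natCast, Nat.mod_eq_of_lt hj] at this
      simp at this
    rw [if_neg (by simpa using hne), add_zero] at h
    convert h using 4
    · push_cast
      abel
    · push_cast
      rw [add_assoc, add_assoc]
      congr 2
  · simp only [hcast, Nat.cast_zero]
  · simp
  · have h := hl v
    rw [if_pos rfl] at h
    have hm : v + ((n + 3 - 1 : ℕ) : Fin (n + 3)) = v - 1 := by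
      rw [eq_sub_iff_add_eq, add_assoc, ← Nat.cast_succ]
      simp only [Nat.add_one_sub_one, Nat.succ_eq_add_one, hcast, add_zero]
    simp only [hm, Nat.cast_one, Nat.cast_zero, add_zero]
    exact h
  · rintro (_ | k)
    · simp only
      rw [add_comm]
      exact h0
    · exact hr k
  · rw [← summable_nat_add_iff 1]
    exact memℓp_two_iff.1 (memℓp_sum_iff.1 (lp.memℓp f))
  · by_contra! hcon
    refine hf ?_
    ext (u | k)
    · have := hcon.1 (u - v).val (u - v).isLt
      simpa using this
    · exact hcon.2 (k + 1)

theorem IsKiteSolution.mem_discreteComponent {μ : ℂ} {c g : ℕ → ℂ}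
    (h : IsKiteSolution (n + 3) μ c g) (h0 : (∃ j < n + 3, c j ≠ 0) ∨ ∃ k, g k ≠ 0) :
    μ ∈ discreteComponent (kite (n + 3) v) (uniformlyLocallyFinite_kite _ v) := by
  -- At the last vertex the sum in `Fin` wraps to 0, and `closed` compensates.
  have hsucc : ∀ d : Fin (n + 3), c (d + 1).val = c (d.val + 1) := by
    intro d
    rw [Fin.val_add_one]
    split_ifs with hd
    · rw [hd, Fin.val_last, ← h.closed]
    · rfl
  let f : EllTwo (Fin (n + 3) ⊕ ℕ) := ⟨Sum.elim (fun u => c (u - v).val) fun k => g (k + 1),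
    memℓp_sum_iff.2 (memℓp_two_iff.2 ((summable_nat_add_iff 1).2 h.summable))⟩
  have hfl : ∀ u, f (Sum.inl u) = c (u - v).val := fun _ => rfl
  have hfr : ∀ k, f (Sum.inr k) = g (k + 1) := fun _ => rfl
  refine ⟨f, ?_, ?_⟩
  · intro hf
    have hl : ∀ u, f (Sum.inl u) = 0 := fun u => by rw [hf]; rfl
    have hr : ∀ k, f (Sum.inr k) = 0 := fun u => by rw [hf]; rfl
    have hc : ∀ j < n + 3, c j = 0 := by
      intro j hj
      have := hl (v + ⟨j, hj⟩)
      rwa [hfl, add_sub_cancel_left] at this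
    rcases h0 with ⟨j, hj, hj0⟩ | ⟨k, hk⟩
    · exact hj0 (hc j hj)
    · cases k with
      | zero => exact hk (h.bridge.trans (hc 0 (by omega)))
      | succ k => exact hk (hr k)
  · ext (u | k)
    · rw [adjacencyOperator_kite_inl]
      simp only [lp.coeFn_smul, Pi.smul_apply, smul_eq_mul, hfl, hfr]
      have e1 : u + 1 - v = (u - v) + 1 := by abel
      rw [e1, hsucc]
      split_ifs with hu
      · subst hu
        have e2 : (u - 1 - u).val = n + 2 := by
          rw [sub_sub_cancel_left, Fin.coe_neg_one]
        have := h.junction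
        rw [e2, sub_self]
        exact this
      · set d := u - 1 - v with hd
        have e2 : u - v = d + 1 := by rw [hd]; abel
        have e3 : (d + 1).val = d.val + 1 := by
          rw [Fin.val_add_one, if_neg]
          intro h'
          rw [h', Fin.last_add_one, sub_eq_zero] at e2
          exact hu e2
        rw [e2, e3, add_zero]
        exact h.cycle _ (e3 ▸ (d + 1).isLt)
    · rcases k with _ | k
      · rw [adjacencyOperator_kite_inr_zero]
        have := h.path 0
        simp only [lp.coeFn_smul, Pi.smul_apply, smul_eq_mul, hfl, hfr, sub_self, Fin.val_zero]
        rw [← h.bridge, add_comm]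
        exact this
      · rw [adjacencyOperator_kite_inr_succ]
        exact h.path (k + 1)

/-! ### Solving the recurrences. -/

/-- The two roots of `X² - μX + 1` have product 1, so one of them lies in the closed unit disc. -/
theorem exists_norm_le_one_eq_add_inv (μ : ℂ) : ∃ x : ℂ, x ≠ 0 ∧ ‖x‖ ≤ 1 ∧ μ = x + x⁻¹ := by
  obtain ⟨s, hs⟩ := IsAlgClosed.exists_pow_nat_eq (μ ^ 2 - 4) (n := 2) (by norm_num)
  set a := (μ + s) / 2 with ha
  set b := (μ - s) / 2 with hb
  have hab : a * b = 1 := by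
    rw [ha, hb]
    linear_combination -hs / 4
  have hsum : a + b = μ := by rw [ha, hb]; ring
  have ha0 : a ≠ 0 := left_ne_zero_of_mul_eq_one hab
  have hb0 : b ≠ 0 := right_ne_zero_of_mul_eq_one hab
  rcases le_total ‖a‖ 1 with h | h
  · exact ⟨a, ha0, h, by rw [← hsum, eq_inv_of_mul_eq_one_right hab]⟩
  · refine ⟨b, hb0, ?_, by rw [← hsum, eq_inv_of_mul_eq_one_left hab, add_comm]⟩
    have := congrArg norm hab
    rw [norm_mul, norm_one] at this
    nlinarith [norm_nonneg b]

/-- A square-summable solution of the recurrence on the path decays geometrically. -/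
theorem eq_mul_pow_of_summable {x : ℂ} (hx : x ≠ 0) (hx1 : ‖x‖ ≤ 1) {g : ℕ → ℂ}
    (hg : ∀ k, g k + g (k + 2) = (x + x⁻¹) * g (k + 1))
    (hs : Summable fun k => ‖g k‖ ^ 2) (k : ℕ) :
    g k = g 0 * x ^ k := by
  have ht : Filter.Tendsto g Filter.atTop (nhds 0) := by
    have := hs.tendsto_atTop_zero.sqrt
    simp only [Real.sqrt_sq (norm_nonneg _), Real.sqrt_zero] at this
    exact tendsto_zero_iff_norm_tendsto_zero.2 this
  -- The difference `g (k + 1) - x * g k` removes the `x ^ k` component and is multiplied by `x⁻¹`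
  -- at each step. Since `‖x‖ ≤ 1` its norm never drops below the initial one, yet it tends to 0, so
  -- it vanishes.
  have hd : ∀ k, (g (k + 1) - x * g k) * x ^ k = g 1 - x * g 0 := by
    intro k
    induction k with
    | zero => simp
    | succ k ih =>
      rw [← ih]
      have h1 := hg k
      have h2 : x * x⁻¹ = 1 := mul_inv_cancel₀ hx
      linear_combination x ^ (k + 1) * h1 + x ^ k * g (k + 1) * h2
  have hle : ∀ k, ‖g 1 - x * g 0‖ ≤ ‖g (k + 1) - x * g k‖ := by
    intro k
    rw [← hd k, norm_mul, norm_pow]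
    exact mul_le_of_le_one_right (norm_nonneg _) (pow_le_one₀ (norm_nonneg _) hx1)
  have hlim : Filter.Tendsto (fun k => ‖g (k + 1) - x * g k‖) Filter.atTop (nhds 0) := by
    have := (((Filter.tendsto_add_atTop_iff_nat 1).2 ht).sub (ht.const_mul x)).norm
    simpa using this
  have h0 : g 1 - x * g 0 = 0 :=
    norm_le_zero_iff.1 (ge_of_tendsto' hlim hle)
  induction k with
  | zero => simp
  | succ k ih =>
    have := hd k
    rw [h0, mul_eq_zero, or_iff_left (pow_ne_zero _ hx), sub_eq_zero] at this
    rw [this, ih]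
    ring

theorem eq_zero_of_summable_norm_eq_one {x : ℂ} (hx : ‖x‖ = 1) {a : ℂ}
    (hs : Summable fun k : ℕ => ‖a * x ^ k‖ ^ 2) : a = 0 := by
  have := hs.tendsto_atTop_zero
  simp only [norm_mul, norm_pow, hx, one_pow, mul_one] at this
  have := tendsto_nhds_unique this tendsto_const_nhds
  simpa using this.symm

/-- Solutions of `c j + c (j + 2) = (x + x⁻¹) c (j + 1)` vanishing at `0`. -/
theorem mul_sub_inv_eq {x : ℂ} (hx : x ≠ 0) {m : ℕ} {c : ℕ → ℂ}
    (hc : ∀ j, j + 1 < m → c j + c (j + 2) = (x + x⁻¹) * c (j + 1)) (h0 : c 0 = 0) :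
    ∀ j, j ≤ m → c j * (x - x⁻¹) = c 1 * (x ^ j - (x⁻¹) ^ j)
  | 0, _ => by simp [h0]
  | 1, _ => by simp
  | j + 2, hj => by
    have h1 := mul_sub_inv_eq hx hc h0 j (by omega)
    have h2 := mul_sub_inv_eq hx hc h0 (j + 1) (by omega)
    have h3 := hc j (by omega)
    have h4 : x * x⁻¹ = 1 := mul_inv_cancel₀ hx
    linear_combination (x - x⁻¹) * h3 - h1 + (x + x⁻¹) * h2
      + c 1 * (x ^ j - (x⁻¹) ^ j) * h4

/-- The degenerate case `x = x⁻¹`, where `mul_sub_inv_eq` says nothing: the solution vanishing at 0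
is `j x ^ (j - 1) c 1`, which has no further zero unless `c 1 = 0`. -/
theorem eq_zero_of_sq_eq_one {x : ℂ} (hx : x ^ 2 = 1) {m : ℕ} (hm : 3 ≤ m) {c : ℕ → ℂ}
    (hc : ∀ j, j + 1 < m → c j + c (j + 2) = (x + x⁻¹) * c (j + 1)) (h0 : c 0 = 0)
    (hcm : c m = 0) : ∀ j, j ≤ m → c j = 0 := by
  have hx0 : x ≠ 0 := by
    rintro rfl
    norm_num at hx
  have hinv : x⁻¹ = x := inv_eq_of_mul_eq_one_right (by rw [← hx]; ring)
  rw [hinv] at hc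
  have key : ∀ j, j + 1 ≤ m → c (j + 1) = (j + 1) * x ^ j * c 1 ∧ c j * x = j * x ^ j * c 1 := by
    intro j
    induction j with
    | zero => intro _; simp [h0]
    | succ j ih =>
      intro hj
      obtain ⟨h1, h2⟩ := ih (by omega)
      have h3 := hc j (by omega)
      constructor
      · push_cast
        apply mul_right_cancel₀ hx0
        linear_combination x * h3 - h2 + 2 * x ^ 2 * h1 + ((j : ℂ) * x ^ j * c 1) * hx
      · push_cast
        linear_combination x * h1
  have h1 : c 1 = 0 := by
    obtain ⟨k, rfl⟩ : ∃ k, m = k + 1 := ⟨m - 1, by omega⟩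
    have := (key k le_rfl).1
    rw [hcm] at this
    have hk : ((k : ℂ) + 1) * x ^ k ≠ 0 :=
      mul_ne_zero (by exact_mod_cast Nat.succ_ne_zero k) (pow_ne_zero _ hx0)
    exact (mul_eq_zero.1 this.symm).resolve_left hk
  intro j hj
  cases j with
  | zero => exact h0
  | succ j => rw [(key j hj).1, h1, mul_zero]

/-- The split is on the junction value. If `c 0 = 0` the path carries nothing and `c` is
proportional to `x ^ j - x ^ (-j)`. If `c 0 ≠ 0`, summability along the path excludes `‖x‖ = 1`, and
`c` is proportional to `x ^ j + x ^ (m - j)`. -/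
theorem IsKiteSolution.pow_eq_one_or {m : ℕ} (hm : 3 ≤ m) {x : ℂ} (hx : x ≠ 0) (hx1 : ‖x‖ ≤ 1)
    {c g : ℕ → ℂ} (h : IsKiteSolution m (x + x⁻¹) c g)
    (h0 : (∃ j < m, c j ≠ 0) ∨ ∃ k, g k ≠ 0) :
    (x ^ m = 1 ∧ x ^ 2 ≠ 1) ∨ (‖x‖ < 1 ∧ x ^ m + 2 * x ^ 2 - 1 = 0) := by
  have hxx : x * x⁻¹ = 1 := mul_inv_cancel₀ hx
  have hg : ∀ k, g k = c 0 * x ^ k := fun k => by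
    rw [← h.bridge]
    exact eq_mul_pow_of_summable hx hx1 h.path h.summable k
  obtain ⟨l, rfl⟩ : ∃ l, m = l + 1 := ⟨m - 1, by omega⟩
  have hl : (x⁻¹) ^ (l + 1) * x ^ (l + 1) = 1 := by rw [← mul_pow, mul_comm, hxx, one_pow]
  by_cases hc0 : c 0 = 0
  · left
    have hcm : c (l + 1) = 0 := h.closed.trans hc0
    have hne : ¬ ∀ j, j ≤ l + 1 → c j = 0 := by
      intro hall
      rcases h0 with ⟨j, hj, hj'⟩ | ⟨k, hk⟩
      · exact hj' (hall j hj.le)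
      · exact hk (by rw [hg, hc0, zero_mul])
    have hx2 : x ^ 2 ≠ 1 := fun hx2 => hne (eq_zero_of_sq_eq_one hx2 hm h.cycle hc0 hcm)
    refine ⟨?_, hx2⟩
    have hxi : x - x⁻¹ ≠ 0 := by
      intro h'
      apply hx2
      linear_combination x * h' + hxx
    have hform := mul_sub_inv_eq hx h.cycle hc0
    have hc1 : c 1 ≠ 0 := by
      intro h1
      refine hne fun j hj => ?_
      have := hform j hj
      rw [h1, zero_mul, mul_eq_zero] at this
      exact this.resolve_right hxi
    have e1 : x ^ (l + 1) - (x⁻¹) ^ (l + 1) = 0 := by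
      have := hform (l + 1) le_rfl
      rw [hcm, zero_mul] at this
      exact (mul_eq_zero.1 this.symm).resolve_left hc1
    -- Vanishing at `m` gives only `x ^ m = ±1`; the junction equation `c l + c 1 = 0` selects the
    -- plus sign.
    have e2 : x ^ l - (x⁻¹) ^ l = -(x - x⁻¹) := by
      have h1 := hform l (by omega)
      have h2 := h.junction
      rw [hg 1, hc0, Nat.add_sub_cancel] at h2
      apply mul_left_cancel₀ hc1
      linear_combination -h1 + (x - x⁻¹) * h2
    apply mul_left_cancel₀ hxi
    have e3 : (x⁻¹) ^ l = x ^ (l + 1) * x := by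
      rw [sub_eq_zero.1 e1, pow_succ, mul_assoc, mul_comm x⁻¹, hxx, mul_one]
    have e4 : x ^ l = x ^ (l + 1) * x⁻¹ := by
      rw [pow_succ, mul_assoc, hxx, mul_one]
    linear_combination -e2 + e4 - e3
  · right
    have hlt : ‖x‖ < 1 := by
      refine lt_of_le_of_ne hx1 fun hx1 => hc0 ?_
      refine eq_zero_of_summable_norm_eq_one hx1 ?_
      simpa only [hg] using h.summable
    refine ⟨hlt, ?_⟩
    have hpow : ∀ k, k ≠ 0 → x ^ k ≠ 1 := by
      intro k hk h1
      have := congrArg norm h1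
      rw [norm_pow, norm_one] at this
      exact (pow_lt_one₀ (norm_nonneg _) hlt hk).ne this
    have hxi : x - x⁻¹ ≠ 0 := by
      intro h'
      apply hpow 2 (by norm_num)
      linear_combination x * h' + hxx
    -- The deviation of `c` from the even solution, scaled to avoid division. It solves the same
    -- recurrence and vanishes at 0 and at `m`, and `x ^ (2m) ≠ 1` then forces it to vanish at 1 and
    -- at `l`, the two cycle neighbours of the junction.
    set e : ℕ → ℂ := fun j => c j * (1 + x ^ (l + 1)) - c 0 * (x ^ j + x ^ (l + 1) * (x⁻¹) ^ j)
      with he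
    have he0 : e 0 = 0 := by simp only [he]; ring
    have hem : e (l + 1) = 0 := by
      simp only [he, h.closed]
      linear_combination -c 0 * hl
    have herec : ∀ j, j + 1 < l + 1 → e j + e (j + 2) = (x + x⁻¹) * e (j + 1) := by
      intro j hj
      simp only [he]
      linear_combination (1 + x ^ (l + 1)) * h.cycle j hj
        + c 0 * (x ^ j + x ^ (l + 1) * (x⁻¹) ^ j) * hxx
    have hform := mul_sub_inv_eq hx herec he0
    have he1 : e 1 = 0 := by
      have := hform (l + 1) le_rfl
      rw [hem, zero_mul] at this
      refine (mul_eq_zero.1 this.symm).resolve_right fun h' => ?_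
      refine hpow ((l + 1) * 2) (by omega) ?_
      rw [pow_mul]
      linear_combination x ^ (l + 1) * h' + hl
    have hel : e l = 0 := by
      have := hform l (by omega)
      rw [he1, zero_mul] at this
      exact (mul_eq_zero.1 this).resolve_right hxi
    have hj := h.junction
    rw [hg 1, Nat.add_sub_cancel] at hj
    simp only [he] at he1 hel
    apply mul_left_cancel₀ hc0
    have e5 : x ^ (l + 1) * (x⁻¹) ^ l = x := by
      rw [pow_succ', mul_assoc, ← mul_pow, hxx, one_pow, mul_one]
    have e6 : x ^ (l + 1) * x⁻¹ = x ^ l := by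
      rw [pow_succ, mul_assoc, hxx, mul_one]
    simp only [pow_one] at he1 hj
    linear_combination (1 + x ^ (l + 1)) * x * hj - x * he1 - x * hel
      - c 0 * (1 + x ^ (l + 1)) * hxx * (-1) - c 0 * x * e5 - c 0 * x * e6

/-! ### Explicit eigenfunctions, odd and even about the junction. -/

theorem isKiteSolution_of_pow_eq_one {m : ℕ} (hm : 3 ≤ m) {x : ℂ} (hxm : x ^ m = 1) :
    IsKiteSolution m (x + x⁻¹) (fun j => x ^ j - (x⁻¹) ^ j) 0 := by
  have hx : x ≠ 0 := by
    rintro rfl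
    rw [zero_pow (by omega)] at hxm
    exact zero_ne_one hxm
  have hxx : x * x⁻¹ = 1 := mul_inv_cancel₀ hx
  refine ⟨fun j _ => ?_, ?_, by simp, ?_, by simp, by simp⟩
  · linear_combination -(x ^ j - (x⁻¹) ^ j) * hxx
  · simp [hxm]
  · obtain ⟨l, rfl⟩ : ∃ l, m = l + 1 := ⟨m - 1, by omega⟩
    have e1 : x ^ l = x⁻¹ := eq_inv_of_mul_eq_one_left (by rw [← pow_succ, hxm])
    simp [e1]

theorem isKiteSolution_of_root {m : ℕ} (hm : 3 ≤ m) {x : ℂ} (hx : x ≠ 0) (hx1 : ‖x‖ < 1)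
    (hp : x ^ m + 2 * x ^ 2 - 1 = 0) :
    IsKiteSolution m (x + x⁻¹) (fun j => x ^ j + x ^ m * (x⁻¹) ^ j)
      (fun k => (1 + x ^ m) * x ^ k) := by
  have hxx : x * x⁻¹ = 1 := mul_inv_cancel₀ hx
  refine ⟨fun j _ => ?_, ?_, by simp, ?_, fun k => ?_, ?_⟩
  · linear_combination -(x ^ j + x ^ m * (x⁻¹) ^ j) * hxx
  · have : x ^ m * (x⁻¹) ^ m = 1 := by rw [← mul_pow, hxx, one_pow]
    simp only [this, pow_zero]
    ring
  · obtain ⟨l, rfl⟩ : ∃ l, m = l + 1 := ⟨m - 1, by omega⟩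
    have e5 : x ^ (l + 1) * (x⁻¹) ^ l = x := by
      rw [pow_succ', mul_assoc, ← mul_pow, hxx, one_pow, mul_one]
    have e6 : x ^ (l + 1) * x⁻¹ = x ^ l := by
      rw [pow_succ, mul_assoc, hxx, mul_one]
    simp only [Nat.add_sub_cancel, e5, pow_one, e6, pow_zero, mul_one]
    have e7 : x ^ l = x⁻¹ * x ^ (l + 1) := by rw [mul_comm, e6]
    rw [e7]
    linear_combination x⁻¹ * hp - 2 * x * hxx
  · linear_combination -(1 + x ^ m) * x ^ k * hxx
  · have : ∀ k, ‖(1 + x ^ m) * x ^ k‖ ^ 2 = ‖1 + x ^ m‖ ^ 2 * (‖x‖ ^ 2) ^ k := fun k => by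
      rw [norm_mul, norm_pow]
      ring
    simp only [this]
    exact (summable_geometric_of_lt_one (by positivity)
      (pow_lt_one₀ (norm_nonneg _) hx1 (by norm_num))).mul_left _

/-! ### Identification of the eigenvalues. -/

theorem exp_pow_add_inv (m i : ℕ) :
    Complex.exp (2 * Real.pi * Complex.I / m) ^ i
        + (Complex.exp (2 * Real.pi * Complex.I / m) ^ i)⁻¹
      = ((2 * Real.cos (2 * Real.pi * i / m) : ℝ) : ℂ) := by
  rw [← Complex.exp_nat_mul, ← Complex.exp_neg]
  push_cast
  rw [Complex.two_cos]
  congr 2 <;> ring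

theorem exists_add_inv_eq_two_cos {m : ℕ} (hm : 3 ≤ m) {x : ℂ} (hxm : x ^ m = 1)
    (hx2 : x ^ 2 ≠ 1) :
    ∃ k : ℕ, 1 ≤ k ∧ k ≤ (m - 1) / 2 ∧
      x + x⁻¹ = ((2 * Real.cos (2 * Real.pi * k / m) : ℝ) : ℂ) := by
  have hm0 : m ≠ 0 := by omega
  have : NeZero m := ⟨hm0⟩
  have hζ := Complex.isPrimitiveRoot_exp m hm0
  obtain ⟨i, hi, rfl⟩ := hζ.eq_pow_of_pow_eq_one hxm
  have h0 : i ≠ 0 := by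
    rintro rfl
    simp at hx2
  have h2 : 2 * i ≠ m := by
    intro h
    apply hx2
    rw [← pow_mul, mul_comm i, h, hζ.pow_eq_one]
  rw [exp_pow_add_inv]
  -- Replacing `i` by `m - i` exchanges `x` and `x⁻¹` and leaves the cosine unchanged. The excluded
  -- exponents `i = 0` and `2 * i = m` are those with `x = ±1`.
  rcases lt_or_gt_of_ne h2 with h | h
  · exact ⟨i, by omega, by omega, rfl⟩
  · refine ⟨m - i, by omega, by omega, ?_⟩
    rw [Nat.cast_sub hi.le, ← Real.cos_two_pi_sub (2 * Real.pi * i / m)]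
    congr 3
    have : (m : ℝ) ≠ 0 := by exact_mod_cast hm0
    field_simp

theorem two_cos_mem_discreteComponent {k : ℕ} (hk1 : 1 ≤ k) (hk : k ≤ (n + 3 - 1) / 2) :
    ((2 * Real.cos (2 * Real.pi * k / (n + 3 : ℕ)) : ℝ) : ℂ)
      ∈ discreteComponent (kite (n + 3) v) (uniformlyLocallyFinite_kite _ v) := by
  have hζ := Complex.isPrimitiveRoot_exp (n + 3) (by omega)
  rw [← exp_pow_add_inv]
  set ζ := Complex.exp (2 * Real.pi * Complex.I / (n + 3 : ℕ))
  refine (isKiteSolution_of_pow_eq_one (m := n + 3) (by omega) ?_).mem_discreteComponent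
    (Or.inl ⟨1, by omega, ?_⟩)
  · rw [← pow_mul, mul_comm, pow_mul, hζ.pow_eq_one, one_pow]
  · intro h
    have h0 : ζ ^ k ≠ 0 := pow_ne_zero _ (Complex.exp_ne_zero _)
    have h2 : ζ ^ (2 * k) = 1 := by
      rw [mul_comm, pow_mul, sq]
      nth_rw 1 [show ζ ^ k = (ζ ^ k)⁻¹ by simpa [sub_eq_zero] using h]
      exact inv_mul_cancel₀ h0
    -- If the odd eigenfunction vanished next to the junction, `n + 3` would divide `2 * k`,
    -- although `0 < 2 * k < n + 3`.
    have := Nat.le_of_dvd (by omega) ((hζ.pow_eq_one_iff_dvd _).1 h2)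
    omega

theorem add_inv_mem_discreteComponent {x : ℂ} (hx : x ≠ 0) (hx1 : ‖x‖ < 1)
    (hp : x ^ (n + 3) + 2 * x ^ 2 - 1 = 0) :
    x + x⁻¹ ∈ discreteComponent (kite (n + 3) v) (uniformlyLocallyFinite_kite _ v) := by
  refine (isKiteSolution_of_root (by omega) hx hx1 hp).mem_discreteComponent
    (Or.inl ⟨0, by omega, ?_⟩)
  intro h
  have h1 : x ^ (n + 3) = -1 := by
    simp only [pow_zero, mul_one] at h
    linear_combination h
  have := congrArg norm h1
  rw [norm_pow, norm_neg, norm_one] at this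
  exact (pow_lt_one₀ (norm_nonneg _) hx1 (by omega)).ne this

/-- Both `x` and its conjugate solve `X² - μX + 1 = 0`, so they are equal or have product 1; the
latter would give `‖x‖ = 1`. -/
theorem conj_eq_of_conj_add_inv_eq {x : ℂ} (hx : x ≠ 0) (hx1 : ‖x‖ < 1)
    (h : (starRingEnd ℂ) (x + x⁻¹) = x + x⁻¹) : (starRingEnd ℂ) x = x := by
  rw [map_add, map_inv₀] at h
  set y := (starRingEnd ℂ) x with hy
  have hy0 : y ≠ 0 := by simpa [hy] using hx
  have h1 : (y - x) * (x * y - 1) = 0 := by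
    field_simp at h
    linear_combination h
  refine sub_eq_zero.1 ((mul_eq_zero.1 h1).resolve_right fun h2 => ?_)
  have := congrArg norm (sub_eq_zero.1 h2)
  rw [norm_mul, hy, Complex.norm_conj, norm_one] at this
  nlinarith [norm_nonneg x]

theorem discreteComponent_kite :
    discreteComponent (kite (n + 3) v) (uniformlyLocallyFinite_kite _ v)
      = (fun t : ℝ => (t : ℂ)) ''
          ({t : ℝ | ∃ k : ℕ, 1 ≤ k ∧ k ≤ (n + 3 - 1) / 2 ∧
              t = 2 * Real.cos (2 * Real.pi * k / (n + 3 : ℕ))} ∪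
            {t : ℝ | ∃ x : ℝ, x ≠ 0 ∧ |x| < 1 ∧ x ^ (n + 3) + 2 * x ^ 2 - 1 = 0 ∧
              t = x + 1 / x}) := by
  ext μ
  constructor
  · intro hμ
    obtain ⟨x, hx, hx1, rfl⟩ := exists_norm_le_one_eq_add_inv μ
    obtain ⟨c, g, hs, h0⟩ := exists_isKiteSolution hμ
    rcases hs.pow_eq_one_or (by omega) hx hx1 h0 with ⟨hxm, hx2⟩ | ⟨hlt, hp⟩
    · obtain ⟨k, hk1, hk, h⟩ := exists_add_inv_eq_two_cos (by omega) hxm hx2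
      exact ⟨_, Or.inl ⟨k, hk1, hk, rfl⟩, h.symm⟩
    -- The eigenvalue is real by self-adjointness, which rules out non-real roots of `p` in the open
    -- disc.
    · obtain ⟨r, rfl⟩ := Complex.conj_eq_iff_real.1 (conj_eq_of_conj_add_inv_eq hx hlt
        (conj_eq_of_mem_graphSpectrum (discreteComponent_subset_graphSpectrum _ _ hμ)))
      refine ⟨r + 1 / r, Or.inr ⟨r, by exact_mod_cast hx, ?_, by exact_mod_cast hp, rfl⟩, ?_⟩
      · rwa [Complex.norm_real] at hlt
      · push_cast
        rw [one_div]
  · rintro ⟨_, ⟨k, hk1, hk, rfl⟩ | ⟨x, hx, hx1, hp, rfl⟩, rfl⟩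
    · exact two_cos_mem_discreteComponent hk1 hk
    · have := add_inv_mem_discreteComponent (n := n) (v := v) (x := (x : ℂ)) (by exact_mod_cast hx)
        (by rwa [Complex.norm_real]) (by exact_mod_cast hp)
      simpa using this

/-! ### Real roots of `p` in `(-1,1)`. -/

theorem existsUnique_root_pos {m : ℕ} (hm : 3 ≤ m) :
    ∃ x₁ : ℝ, ∀ x : ℝ, (0 < x ∧ x < 1 ∧ x ^ m + 2 * x ^ 2 - 1 = 0) ↔ x = x₁ := by
  have hm0 : m ≠ 0 := by omega
  have hc : ContinuousOn (fun x : ℝ => x ^ m + 2 * x ^ 2 - 1) (Set.Icc 0 1) := by fun_prop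
  obtain ⟨a, ⟨ha0, ha1⟩, ha⟩ := intermediate_value_Ioo zero_le_one hc
    (show (0 : ℝ) ∈ _ by constructor <;> norm_num [hm0])
  refine ⟨a, fun x => ⟨?_, ?_⟩⟩
  · rintro ⟨hx0, -, hx⟩
    have hmono : ∀ y z : ℝ, 0 < y → y < z → y ^ m + 2 * y ^ 2 - 1 < z ^ m + 2 * z ^ 2 - 1 := by
      intro y z hy hyz
      have h1 := pow_lt_pow_left₀ hyz hy.le hm0
      have h2 := pow_lt_pow_left₀ hyz hy.le two_ne_zero
      linarith
    rcases lt_trichotomy x a with h | h | h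
    · have := hmono x a hx0 h
      simp only at ha
      linarith
    · exact h
    · have := hmono a x ha0 h
      simp only at ha
      linarith
  · rintro rfl
    exact ⟨ha0, ha1, ha⟩

/-- For odd `m = l + 2` this polynomial is `-p(-y)`, which has a root at `y = 1`. Dividing out `1 -
y` leaves `1 + y = y² G(y)`. The right side minus the left is `-1` at 0 and `l - 2` at 1, hence a
crossing; for `m = 3`, that is `l = 1`, there is none. -/
theorem existsUnique_root_odd_aux {l : ℕ} (hl : 3 ≤ l) :
    ∃ b : ℝ, ∀ y : ℝ, (0 < y ∧ y < 1 ∧ 1 - 2 * y ^ 2 + y ^ (l + 2) = 0) ↔ y = b := by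
  set G : ℝ → ℝ := fun y => ∑ k ∈ Finset.range l, y ^ k with hG
  have hfac : ∀ y : ℝ, 1 - 2 * y ^ 2 + y ^ (l + 2) = (1 - y) * (1 + y - y ^ 2 * G y) := by
    intro y
    have := geom_sum_mul y l
    simp only [hG]
    linear_combination -y ^ 2 * this
  have hc : ContinuousOn (fun y : ℝ => y ^ 2 * G y - (1 + y)) (Set.Icc 0 1) := by
    simp only [hG]
    fun_prop
  have hl' : (3 : ℝ) ≤ l := by exact_mod_cast hl
  obtain ⟨b, ⟨hb0, hb1⟩, hb⟩ := intermediate_value_Ioo zero_le_one hc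
    (show (0 : ℝ) ∈ _ by
      constructor
      · norm_num
      · simp only [hG, one_pow, Finset.sum_const, Finset.card_range, nsmul_eq_mul]
        linarith)
  simp only [sub_eq_zero] at hb
  refine ⟨b, fun y => ⟨?_, ?_⟩⟩
  · rintro ⟨hy0, hy1, hy⟩
    rw [hfac, mul_eq_zero, or_iff_right (by linarith), sub_eq_zero] at hy
    have hlt : ∀ s t : ℝ, 0 < s → s < t → 1 + s = s ^ 2 * G s → 1 + t = t ^ 2 * G t → False := by
      intro s t hs hst h1 h2
      have hle : G s ≤ G t :=
        Finset.sum_le_sum fun k _ => pow_le_pow_left₀ hs.le hst.le k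
      -- Strict monotonicity of `y² / (1 + y)`, with denominators cleared; as `G` is also monotone,
      -- `y² G(y) / (1 + y)` takes the value 1 at most once.
      have h3 : (1 + t) * s ^ 2 < (1 + s) * t ^ 2 := by nlinarith [mul_pos hs (hs.trans hst)]
      rw [h1, h2] at h3
      have h4 : s ^ 2 * t ^ 2 * G s ≤ s ^ 2 * t ^ 2 * G t :=
        mul_le_mul_of_nonneg_left hle (by positivity)
      linarith
    rcases lt_trichotomy y b with h | h | h
    · exact (hlt y b hy0 h hy hb.symm).elim
    · exact h
    · exact (hlt b y hb0 h hb.symm hy).elim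
  · rintro rfl
    refine ⟨hb0, hb1, ?_⟩
    rw [hfac, hb, sub_self, mul_zero]

theorem existsUnique_root_neg {m : ℕ} (hm : 4 ≤ m) :
    ∃ x₂ : ℝ, ∀ x : ℝ, (-1 < x ∧ x < 0 ∧ x ^ m + 2 * x ^ 2 - 1 = 0) ↔ x = x₂ := by
  -- For even `m` the polynomial is even, so the negative root mirrors the positive one; for odd `m`
  -- the substitution `y = -x` leads to the auxiliary polynomial.
  rcases Nat.even_or_odd m with he | ho
  · obtain ⟨a, ha⟩ := existsUnique_root_pos (m := m) (by omega)
    refine ⟨-a, fun x => ?_⟩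
    rw [← neg_eq_iff_eq_neg, ← ha (-x), he.neg_pow, neg_sq]
    constructor <;> rintro ⟨h1, h2, h3⟩ <;> exact ⟨by linarith, by linarith, h3⟩
  · have hm5 : 5 ≤ m := by
      obtain ⟨k, rfl⟩ := ho
      omega
    obtain ⟨l, rfl⟩ : ∃ l, m = l + 2 := ⟨m - 2, by omega⟩
    obtain ⟨b, hb⟩ := existsUnique_root_odd_aux (l := l) (by omega)
    refine ⟨-b, fun x => ?_⟩
    rw [← neg_eq_iff_eq_neg, ← hb (-x), ho.neg_pow, neg_sq]
    constructor <;> rintro ⟨h1, h2, h3⟩ <;> exact ⟨by linarith, by linarith, by linarith⟩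

theorem cube_add_ne_zero {x : ℝ} (h1 : -1 < x) (h0 : x < 0) : x ^ 3 + 2 * x ^ 2 - 1 ≠ 0 := by
  have h : x ^ 3 + 2 * x ^ 2 - 1 = (x + 1) * (x * (x + 1) - 1) := by ring
  rw [h]
  have h2 : x * (x + 1) < 0 := mul_neg_of_neg_of_pos h0 (by linarith)
  exact mul_ne_zero (by linarith) (by linarith)

end TailGraph

end

/-! ### Assembly: the roots of `p` inserted into the description of the eigenvalues. -/

theorem mainTheorem3 (m : ℕ) (hm : 3 ≤ m) (v : Fin m) :
    -- the real numbers are embedded in `ℂ`, over which the spectra are taken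
    (TailGraph.graphSpectrum (TailGraph.kite m v) (TailGraph.uniformlyLocallyFinite_kite m v)
        = (fun t : ℝ => (t : ℂ)) '' Set.Icc (-2) 2 ∪
          TailGraph.discreteComponent (TailGraph.kite m v)
            (TailGraph.uniformlyLocallyFinite_kite m v)) ∧
    (4 ≤ m → ∃ x₁ x₂ : ℝ,
      (∀ x : ℝ, (0 < x ∧ x < 1 ∧ x ^ m + 2 * x ^ 2 - 1 = 0) ↔ x = x₁) ∧
      (∀ x : ℝ, (-1 < x ∧ x < 0 ∧ x ^ m + 2 * x ^ 2 - 1 = 0) ↔ x = x₂) ∧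
      TailGraph.discreteComponent (TailGraph.kite m v)
          (TailGraph.uniformlyLocallyFinite_kite m v)
        = (fun t : ℝ => (t : ℂ)) ''
          ({t : ℝ | ∃ k : ℕ, 1 ≤ k ∧ k ≤ (m - 1) / 2 ∧
              t = 2 * Real.cos (2 * Real.pi * k / m)} ∪
            {x₁ + 1 / x₁, x₂ + 1 / x₂})) ∧
    (m = 3 → ∃ x₁ : ℝ,
      (∀ x : ℝ, (0 < x ∧ x < 1 ∧ x ^ m + 2 * x ^ 2 - 1 = 0) ↔ x = x₁) ∧
      (∀ x : ℝ, -1 < x → x < 0 → x ^ m + 2 * x ^ 2 - 1 ≠ 0) ∧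
      TailGraph.discreteComponent (TailGraph.kite m v)
          (TailGraph.uniformlyLocallyFinite_kite m v)
        = (fun t : ℝ => (t : ℂ)) ''
          ({t : ℝ | ∃ k : ℕ, 1 ≤ k ∧ k ≤ (m - 1) / 2 ∧
              t = 2 * Real.cos (2 * Real.pi * k / m)} ∪
            {x₁ + 1 / x₁})) := by
  obtain ⟨n, rfl⟩ : ∃ n, m = n + 3 := ⟨m - 3, by omega⟩
  refine ⟨TailGraph.graphSpectrum_kite, fun hm4 => ?_, fun hm3 => ?_⟩
  · obtain ⟨x₁, h₁⟩ := TailGraph.existsUnique_root_pos hm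
    obtain ⟨x₂, h₂⟩ := TailGraph.existsUnique_root_neg hm4
    refine ⟨x₁, x₂, h₁, h₂, ?_⟩
    rw [TailGraph.discreteComponent_kite]
    congr 2
    ext t
    simp only [Set.mem_ofPred_eq, Set.mem_insert_iff, Set.mem_singleton_iff]
    constructor
    · rintro ⟨x, hx, hx1, hp, rfl⟩
      rw [abs_lt] at hx1
      rcases lt_or_gt_of_ne hx with h | h
      · exact Or.inr (by rw [(h₂ x).1 ⟨hx1.1, h, hp⟩])
      · exact Or.inl (by rw [(h₁ x).1 ⟨h, hx1.2, hp⟩])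
    · rintro (rfl | rfl)
      · obtain ⟨h0, h1, hp⟩ := (h₁ x₁).2 rfl
        exact ⟨x₁, h0.ne', abs_lt.2 ⟨by linarith, h1⟩, hp, rfl⟩
      · obtain ⟨h1, h0, hp⟩ := (h₂ x₂).2 rfl
        exact ⟨x₂, h0.ne, abs_lt.2 ⟨h1, by linarith⟩, hp, rfl⟩
  · obtain ⟨x₁, h₁⟩ := TailGraph.existsUnique_root_pos hm
    have h₂ : ∀ x : ℝ, -1 < x → x < 0 → x ^ (n + 3) + 2 * x ^ 2 - 1 ≠ 0 := by
      rw [hm3]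
      exact fun x => TailGraph.cube_add_ne_zero
    refine ⟨x₁, h₁, h₂, ?_⟩
    rw [TailGraph.discreteComponent_kite]
    congr 2
    ext t
    simp only [Set.mem_ofPred_eq, Set.mem_singleton_iff]
    constructor
    · rintro ⟨x, hx, hx1, hp, rfl⟩
      rw [abs_lt] at hx1
      rcases lt_or_gt_of_ne hx with h | h
      · exact (h₂ x hx1.1 h hp).elim
      · rw [(h₁ x).1 ⟨h, hx1.2, hp⟩]
    · rintro rfl
      obtain ⟨h0, h1, hp⟩ := (h₁ x₁).2 rfl
      exact ⟨x₁, h0.ne', abs_lt.2 ⟨by linarith, h1⟩, hp, rfl⟩
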